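/- Let $N\ge 1$ be an integer, $\tilde s\in(0,1)$ and $0<\tilde m<\frac{N-2+2\tilde s}{N}$. Then there is a constant $K>0$, depending only on $N,\tilde s,\tilde m$, such that for every $T>0$ the function given for $x\in\mathbb R^N\setminus\{0\}$ by $$v(x,t)=K\,(T-t)^{\frac1{1-\tilde m}}\,|x|^{-\frac{2-2\tilde s}{1-\tilde m}}\quad (0\le t\le T),\qquad v(x,t)=0\quad (t>T),$$ is a very singular solution with extinction at time $T$ of the equation $$v_t=\nabla\cdot\big(v^{\tilde m-1}\,\nabla(-\Delta)^{-\tilde s}v\big)\qquad\text{in }\mathbb R^N\times(0,\infty).$$ This means the following. (1) For every $t\ge0$ the functions $v(\cdot,t)$ and $p(\cdot,t)=(-\Delta)^{-\tilde s}v(\cdot,t)$ are tempered distributions given by measurable functions. Here $(-\Delta)^{-\tilde s}$ is the operator with Fourier symbol $(2\pi|\xi|)^{-2\tilde s}$: $\int p\,(-\Delta)^{\tilde s}\psi\,dx=\int v\,\psi\,dx$ for all Schwartz functions $\psi$ such that $(-\Delta)^{\tilde s}\psi$ is a Schwartz function. Moreover $p(\cdot,t)$ is radial and $p(x,t)=o(|x|^2)$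 as $|x|\to\infty$, which determines $p(\cdot,t)$ up to an additive constant and hence determines $\nabla p(\cdot,t)$. (2) The equation $v_t=\nabla\cdot(v^{\tilde m-1}\nabla p)$ holds pointwise for all $x\neq0$, $t>0$ (where $v=0$, the flux $v^{\tilde m-1}\nabla p$ is understood to be $0$). (3) The equation also holds weakly in the whole space, the origin included: $v$ and $v^{\tilde m-1}\nabla p$ are locally integrable in $\mathbb R^N\times[0,\infty)$, $v(\cdot,0)$ is locally integrable in $\mathbb R^N$, and $$\int_0^\infty\!\!\int_{\mathbb R^N}\big(v\,\varphi_t-v^{\tilde m-1}\nabla p\cdot\nabla\varphi\big)\,dx\,dt+\int_{\mathbb R^N}v(x,0)\varphi(x,0)\,dx=0\qquad\text{for all }\varphi\in C_c^\infty(\mathbb R^N\times\mathbb R).$$ (4) For $0\le t<T$ one has $v(x,t)>0$ for $x\neq0$ and $v(x,t)\to+\infty$ as $x\to0$, while $v(\cdot,t)=0$ for $t>T$. -/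

import Mathlib

open MeasureTheory Filter Topology Asymptotics Set
open scoped ContDiff FourierTransform SchwartzMap

noncomputable section

namespace FracPressure

/-- The Euclidean space `ℝ^N`. -/
abbrev Space (N : ℕ) : Type := EuclideanSpace ℝ (Fin N)

variable {N : ℕ}

/-- `f` is a function on `ℝ^N` of at most polynomial growth in the integral sense; integration
against Schwartz functions makes it a tempered distribution. -/
def IsTemperedFun (f : Space N → ℝ) : Prop :=
  ∃ k : ℕ, Integrable (fun x => ((1 + ‖x‖) ^ k)⁻¹ * f x)

/-- `φ = (-Δ)^s ψ` for Schwartz functions, by the Fourier symbol: `φ̂(ξ) = (2π|ξ|)^{2s} ψ̂(ξ)`,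
where `ψ̂(ξ) = ∫ e^{-2πi x·ξ} ψ(x) dx`. -/
def IsFracLaplacianOf (s : ℝ) (φ ψ : 𝓢(Space N, ℂ)) : Prop :=
  ∀ ξ : Space N,
    𝓕 (φ : Space N → ℂ) ξ = (((2 * Real.pi * ‖ξ‖) ^ (2 * s) : ℝ) : ℂ) * 𝓕 (ψ : Space N → ℂ) ξ

/-- `p = (-Δ)^{-s} f`, by the Fourier symbol `(2π|ξ|)^{-2s}`.

The symbol is singular at `ξ = 0`, so the identity `p̂ = (2π|ξ|)^{-2s} f̂` between tempered
distributions is imposed away from the origin: `fourier` tests it against all Schwartz `ψ` for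
which `φ = (-Δ)^s ψ` is again Schwartz (in particular against every `ψ` whose Fourier transform
vanishes near `0`). This fixes `p` up to a polynomial. The polynomial is then removed by the two
last fields: `p` grows less than quadratically, and, as `(-Δ)^{-s}` commutes with isometries, `p`
has every linear symmetry of `f`. When `f` is invariant under `x ↦ -x` (for instance radial),
`p` is thereby unique up to an additive constant, so that `∇ p = ∇ (-Δ)^{-s} f` is unique. -/
structure IsInvFracLaplacian (s : ℝ) (f p : Space N → ℝ) : Prop where
  tempered_source : IsTemperedFun f
  tempered : IsTemperedFun p
  fourier : ∀ φ ψ : 𝓢(Space N, ℂ), IsFracLaplacianOf s φ ψ →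
    ∫ x, (p x : ℂ) * φ x = ∫ x, (f x : ℂ) * ψ x
  subquadratic : p =o[Bornology.cobounded (Space N)] fun x => ‖x‖ ^ 2
  symmetric : ∀ R : Space N ≃ₗᵢ[ℝ] Space N, (∀ x, f (R x) = f x) → ∀ x, p (R x) = p x

/-- The divergence of a vector field: the trace of its derivative. -/
def divergence (F : Space N → Space N) (x : Space N) : ℝ :=
  LinearMap.trace ℝ (Space N) (fderiv ℝ F x : Space N →ₗ[ℝ] Space N)

/-- The vector field `v^{m-1} ∇p` at time `t` (the gradient is the spatial one). Where `v = 0`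
and `m < 1`, the real power `v^{m-1}` is `0` in Lean, so that there the field is `0`. -/
def flux (m : ℝ) (v p : Space N → ℝ → ℝ) (t : ℝ) (x : Space N) : Space N :=
  (v x t) ^ (m - 1) • gradient (fun y => p y t) x

/-- Lebesgue measure on `ℝ^N × (0, ∞)`. -/
def spaceTime (N : ℕ) : Measure (Space N × ℝ) :=
  (volume : Measure (Space N)).prod (volume.restrict (Ioi (0 : ℝ)))

/-- `v_t = ∇ · (v^{m-1} ∇p)` holds pointwise at all `(x, t)` with `x ≠ 0`, `t > 0`. -/
def SolvesOffOrigin (m : ℝ) (v p : Space N → ℝ → ℝ) : Prop :=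
  ∀ t : ℝ, 0 < t → ∀ x : Space N, x ≠ 0 →
    DifferentiableAt ℝ (fun y => p y t) x ∧
    DifferentiableAt ℝ (flux m v p t) x ∧
    HasDerivAt (fun τ => v x τ) (divergence (flux m v p t) x) t

/-- `v_t = ∇ · (v^{m-1} ∇p)` holds weakly in `ℝ^N × (0, ∞)`, the origin included, with
initial datum `v(·, 0)`:
`∫₀^∞ ∫ (v ∂ₜφ - v^{m-1} ∇p · ∇φ) dx dt + ∫ v(x,0) φ(x,0) dx = 0` for all test functions `φ`. -/
structure SolvesWeakly (m : ℝ) (v p : Space N → ℝ → ℝ) : Prop where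
  initial_locInt : LocallyIntegrable (fun x => v x 0)
  locInt : LocallyIntegrable (fun z : Space N × ℝ => v z.1 z.2) (spaceTime N)
  flux_locInt : LocallyIntegrable (fun z : Space N × ℝ => flux m v p z.2 z.1) (spaceTime N)
  weak : ∀ φ : Space N × ℝ → ℝ, ContDiff ℝ ∞ φ → HasCompactSupport φ →
    (∫ z, (v z.1 z.2 * fderiv ℝ φ z (0, 1) - fderiv ℝ φ z (flux m v p z.2 z.1, 0)) ∂(spaceTime N))
      + ∫ x, v x 0 * φ (x, 0) = 0

/-- `v` solves `v_t = ∇ · (v^{m-1} ∇(-Δ)^{-s} v)` for `t > 0`, classically away from `x = 0` and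
weakly in the whole space. -/
def IsSolution (s m : ℝ) (v : Space N → ℝ → ℝ) : Prop :=
  ∃ p : Space N → ℝ → ℝ,
    (∀ t : ℝ, 0 ≤ t → IsInvFracLaplacian s (fun x => v x t) (fun x => p x t)) ∧
    SolvesOffOrigin m v p ∧ SolvesWeakly m v p

/-- A very singular solution that lives up to the time `T` and vanishes afterwards: a solution
that is positive and blows up at `x = 0` at every time before `T`, and is zero after `T`. -/
structure IsVerySingularSolutionWithExtinction (s m T : ℝ) (v : Space N → ℝ → ℝ) : Prop where
  solution : IsSolution s m v
  pos : ∀ t ∈ Ico 0 T, ∀ x : Space N, x ≠ 0 → 0 < v x t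
  singular : ∀ t ∈ Ico 0 T, Tendsto (fun x => v x t) (𝓝[≠] (0 : Space N)) atTop
  extinct : ∀ t, T < t → ∀ x, v x t = 0

end FracPressure

end

/-! # Very singular separable solutions of a fractional pressure equation -/

namespace FracPressure

variable {N : ℕ}

/-! Put `a = (2 - 2s) / (1 - m)`; the upper bound on `m` says exactly that `a < N`. Look for `v =
h(t) ‖x‖^(-a)`. Its potential should be radial with gradient `-κ h(t) ‖x‖^(-b - 2) x`, where `b = a
- 2s` and `κ > 0`. The choice of `a` makes the powers combine: `v^(m-1) ∇p = -κ h^m ‖x‖^(-a) x`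
(`flux_eq`), whose divergence is `-κ (N - a) h^m ‖x‖^(-a)`. The equation thus becomes the ODE `h' =
-κ (N - a) h^m`. As `0 < m < 1`, it has a nonnegative `C¹` solution that vanishes from time `T` on
(`hasDerivAt_extinction`), and its coefficient is the constant `K`.

The analytic work is to identify the potential (`exists_isInvFracLaplacian`). Writing powers of the
norm as Mellin integrals of Gaussians, and moving the Fourier transform across each Gaussian, gives
the transform of `‖x‖^(-a)`. The exponent `b` lies only in `(-2, N)`, so for `b ≤ 0` the Mellin
integral diverges. Subtracting the Gaussian value at `r = 1` restores convergence, and the result is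
a multiple of `powPrimitive b`, which treats negative, zero (logarithm) and positive `b` uniformly.
The subtracted term is constant in `x`, and it is invisible to `φ = (-Δ)^s ψ` because `∫ φ = 0`.

For the weak equation no point mass may appear at the origin. Instead of cutting out a ball,
`integral_norm_rpow_mul_fderiv_self` differentiates the scaling law of `∫ ‖x‖^(-a) χ(l x) dx` at `l
= 1`; this requires only local integrability of the weight, that is `a < N`. -/

/-! ### Normalized primitives of powers. -/

/-- The primitive of `r ↦ r ^ (-b - 1)` on `(0, ∞)` that vanishes at `r = 1`. -/
noncomputable def powPrimitive (b r : ℝ) : ℝ :=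
  if b = 0 then Real.log r else (1 - r ^ (-b)) / b

lemma powPrimitive_one (b : ℝ) : powPrimitive b 1 = 0 := by
  simp [powPrimitive]

lemma hasDerivAt_powPrimitive (b : ℝ) {r : ℝ} (hr : 0 < r) :
    HasDerivAt (powPrimitive b) (r ^ (-b - 1)) r := by
  by_cases hb : b = 0
  · have h : powPrimitive b = Real.log := by ext; simp [powPrimitive, hb]
    rw [h, hb, neg_zero, zero_sub, Real.rpow_neg_one]
    exact Real.hasDerivAt_log hr.ne'
  · have h : powPrimitive b = fun r => (1 - r ^ (-b)) / b := by ext; simp [powPrimitive, hb]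
    rw [h]
    convert! ((Real.hasDerivAt_rpow_const (p := -b) (Or.inl hr.ne')).const_sub 1).div_const b using 1
    field_simp

lemma measurable_powPrimitive (b : ℝ) : Measurable (powPrimitive b) := by
  unfold powPrimitive
  split_ifs
  · exact Real.measurable_log
  · fun_prop

/-- One bound serves two purposes: `δ < n` gives integrability at the origin in dimension `n`, and
`γ < 2` gives subquadratic growth. The constant 1 and the logarithm are both absorbed by a negative
power near 0 and a positive power near infinity. -/
lemma abs_powPrimitive_le {b n : ℝ} (hn : 0 < n) (hb : b < n) (hb2 : -2 < b) :
    ∃ δ γ C : ℝ, δ < n ∧ 0 < γ ∧ γ < 2 ∧ 0 < δ ∧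
      ∀ r : ℝ, 0 < r → |powPrimitive b r| ≤ C * (r ^ (-δ) + r ^ γ) := by
  rcases lt_trichotomy b 0 with h | h | h
  · refine ⟨n / 2, -b, 2 / |b|, by linarith, by linarith, by linarith, by linarith, fun r hr => ?_⟩
    have h0 : 0 < |b| := abs_pos.2 h.ne
    have h1 : 1 ≤ r ^ (-(n / 2)) + r ^ (-b) := by
      rcases le_total r 1 with h1 | h1
      · have := Real.one_le_rpow_of_pos_of_le_one_of_nonpos hr h1 (by linarith : -(n / 2) ≤ 0)
        have := Real.rpow_pos_of_pos hr (-b)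
        linarith
      · have := Real.one_le_rpow h1 (by linarith : 0 ≤ -b)
        have := Real.rpow_pos_of_pos hr (-(n / 2))
        linarith
    have h2 := Real.rpow_pos_of_pos hr (-b)
    have h3 := Real.rpow_pos_of_pos hr (-(n / 2))
    rw [powPrimitive, if_neg h.ne, abs_div, div_mul_eq_mul_div]
    gcongr
    rw [abs_le]
    constructor <;> linarith
  · have hd : 0 < min n 1 / 2 := by positivity
    refine ⟨min n 1 / 2, min n 1 / 2, 1 / (min n 1 / 2), ?_, hd, ?_, hd, fun r hr => ?_⟩
    · have := min_le_left n 1; linarith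
    · have := min_le_right n 1; linarith
    set d := min n 1 / 2
    have h1 := Real.log_le_rpow_div hr.le hd
    have h2 := Real.log_le_rpow_div (inv_pos.2 hr).le hd
    rw [Real.log_inv, Real.inv_rpow hr.le, ← Real.rpow_neg hr.le] at h2
    have h3 := Real.rpow_pos_of_pos hr d
    have h4 := Real.rpow_pos_of_pos hr (-d)
    have h5 : 0 < r ^ d / d := by positivity
    have h6 : 0 < r ^ (-d) / d := by positivity
    rw [powPrimitive, if_pos h, abs_le, one_div_mul_eq_div, add_div]
    constructor <;> linarith
  · refine ⟨b, 1, 2 / |b|, hb, one_pos, one_lt_two, h, fun r hr => ?_⟩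
    have h0 : 0 < |b| := abs_pos.2 h.ne'
    have h1 : 1 ≤ r ^ (-b) + r ^ (1 : ℝ) := by
      have h2 := Real.rpow_pos_of_pos hr (-b)
      rcases le_total r 1 with h1 | h1
      · have := Real.one_le_rpow_of_pos_of_le_one_of_nonpos hr h1 (by linarith : -b ≤ 0)
        simp only [Real.rpow_one]
        linarith
      · simp only [Real.rpow_one]
        linarith
    have h2 := Real.rpow_pos_of_pos hr (-b)
    rw [Real.rpow_one] at h1 ⊢
    rw [powPrimitive, if_neg h.ne', abs_div, div_mul_eq_mul_div]
    gcongr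
    rw [abs_le]
    constructor <;> linarith

lemma integrableOn_rpow_mul_exp_neg_mul {a c : ℝ} (ha : 0 < a) (hc : 0 < c) :
    IntegrableOn (fun l : ℝ => l ^ (a - 1) * Real.exp (-(c * l))) (Ioi 0) := by
  have := integrableOn_rpow_mul_exp_neg_mul_rpow (p := 1) (s := a - 1) (by linarith) one_pos hc
  simpa using this

/-! ### A Frullani integral: `powPrimitive` as a regularized Mellin transform. -/

section Frullani

variable {b r : ℝ}

lemma intervalIntegral_gaussian_kernel (b r : ℝ) {l : ℝ} (hl : 0 < l) :
    ∫ ρ in (1 : ℝ)..r, 2 * Real.pi * ρ * (l ^ (b / 2) * Real.exp (-(Real.pi * ρ ^ 2 * l))) =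
      -(l ^ (b / 2 - 1) * (Real.exp (-(Real.pi * r ^ 2 * l)) - Real.exp (-(Real.pi * l)))) := by
  have hd : ∀ ρ : ℝ, HasDerivAt (fun ρ => -(l ^ (b / 2 - 1) * Real.exp (-(Real.pi * ρ ^ 2 * l))))
      (2 * Real.pi * ρ * (l ^ (b / 2) * Real.exp (-(Real.pi * ρ ^ 2 * l)))) ρ := by
    intro ρ
    have h1 : HasDerivAt (fun ρ : ℝ => -(Real.pi * ρ ^ 2 * l)) (-(Real.pi * (2 * ρ) * l)) ρ := by
      convert! (((hasDerivAt_pow 2 ρ).const_mul Real.pi).mul_const l).neg using 1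
      simp
    convert! (h1.exp.const_mul (l ^ (b / 2 - 1))).neg using 1
    have h2 : l ^ (b / 2) = l ^ (b / 2 - 1) * l := by
      rw [← Real.rpow_add_one hl.ne']; ring_nf
    rw [h2]; ring
  rw [intervalIntegral.integral_eq_sub_of_hasDerivAt (fun ρ _ => hd ρ)
    (Continuous.intervalIntegrable (by fun_prop) _ _)]
  simp only [one_pow, mul_one]
  ring

lemma integral_gaussian_kernel (hb : -2 < b) {ρ : ℝ} (hρ : 0 < ρ) :
    ∫ l in Ioi (0 : ℝ), 2 * Real.pi * ρ * (l ^ (b / 2) * Real.exp (-(Real.pi * ρ ^ 2 * l))) =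
      2 * Real.pi ^ (-(b / 2)) * Real.Gamma (b / 2 + 1) * ρ ^ (-b - 1) := by
  rw [integral_const_mul]
  have h := Real.integral_rpow_mul_exp_neg_mul_Ioi (a := b / 2 + 1) (r := Real.pi * ρ ^ 2)
    (by linarith) (by positivity)
  rw [add_sub_cancel_right] at h
  rw [h, one_div, Real.inv_rpow (by positivity), ← Real.rpow_neg (by positivity),
    Real.mul_rpow (by positivity) (by positivity), ← Real.rpow_natCast, ← Real.rpow_mul hρ.le]
  have h1 : Real.pi ^ (-(b / 2)) = Real.pi * Real.pi ^ (-(b / 2 + 1)) := by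
    rw [show -(b / 2) = 1 + -(b / 2 + 1) by ring, Real.rpow_add Real.pi_pos, Real.rpow_one]
  have h2 : ρ ^ (-b - 1) = ρ * ρ ^ ((2 : ℕ) * -(b / 2 + 1) : ℝ) := by
    rw [show -b - 1 = 1 + (2 : ℕ) * -(b / 2 + 1) by push_cast; ring, Real.rpow_add hρ, Real.rpow_one]
  rw [h1, h2]; ring

lemma continuousOn_rpow_uIcc (hr : 0 < r) (c : ℝ) : ContinuousOn (fun ρ : ℝ => ρ ^ c) (uIcc 1 r) := by
  intro ρ hρ
  have h0 : 0 < ρ := lt_of_lt_of_le (lt_min one_pos hr) hρ.1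
  exact (Real.continuousAt_rpow_const _ _ (Or.inl h0.ne')).continuousWithinAt

/-- By Tonelli it suffices to integrate first in `l`, which leaves a power of `ρ`, continuous
between `1` and `r`. The condition `-2 < b` is convergence at `l = 0`. -/
lemma integrable_prod_gaussian_kernel (hb : -2 < b) (hr : 0 < r) :
    Integrable (fun z : ℝ × ℝ =>
        2 * Real.pi * z.2 * (z.1 ^ (b / 2) * Real.exp (-(Real.pi * z.2 ^ 2 * z.1))))
      ((volume.restrict (Ioi (0 : ℝ))).prod (volume.restrict (uIoc 1 r))) := by
  have hpos : ∀ ρ ∈ uIoc 1 r, 0 < ρ := fun ρ hρ => lt_of_le_of_lt (le_min one_pos.le hr.le) hρ.1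
  rw [integrable_prod_iff' (Measurable.aestronglyMeasurable (by fun_prop))]
  constructor
  · filter_upwards [ae_restrict_mem measurableSet_uIoc] with ρ hρ
    have h0 := hpos ρ hρ
    have h := integrableOn_rpow_mul_exp_neg_mul (a := b / 2 + 1) (c := Real.pi * ρ ^ 2)
      (by linarith) (by positivity)
    rw [add_sub_cancel_right] at h
    exact h.const_mul _
  · have h1 : Integrable (fun ρ : ℝ => 2 * Real.pi ^ (-(b / 2)) * Real.Gamma (b / 2 + 1)
        * ρ ^ (-b - 1)) (volume.restrict (uIoc 1 r)) := by
      refine Integrable.const_mul ?_ _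
      exact (intervalIntegrable_iff.1 (continuousOn_rpow_uIcc hr _).intervalIntegrable)
    refine h1.congr ?_
    filter_upwards [ae_restrict_mem measurableSet_uIoc] with ρ hρ
    have h0 := hpos ρ hρ
    rw [← integral_gaussian_kernel hb h0]
    refine setIntegral_congr_fun measurableSet_Ioi fun l hl => ?_
    have hl : 0 < l := hl
    exact (Real.norm_of_nonneg (by positivity)).symm

lemma integral_rpow_uIoc (b : ℝ) (hr : 0 < r) :
    ∫ ρ in (1 : ℝ)..r, ρ ^ (-b - 1) = powPrimitive b r := by
  rw [intervalIntegral.integral_eq_sub_of_hasDerivAt (f := powPrimitive b), powPrimitive_one,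
    sub_zero]
  · intro ρ hρ
    exact hasDerivAt_powPrimitive b (lt_of_lt_of_le (lt_min one_pos hr) hρ.1)
  · exact (continuousOn_rpow_uIcc hr _).intervalIntegrable

/-- The difference of two heat kernels, whose Mellin transform is `powPrimitive`. -/
lemma integrableOn_rpow_mul_exp_sub_exp (hb : -2 < b) (hr : 0 < r) :
    IntegrableOn (fun l : ℝ => l ^ (b / 2 - 1) *
      (Real.exp (-(Real.pi * r ^ 2 * l)) - Real.exp (-(Real.pi * l)))) (Ioi 0) := by
  have h := (integrable_prod_gaussian_kernel hb hr).integral_prod_left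
  -- The sign is the orientation of the integral from `1` to `r`, since `uIoc` forgets it.
  refine (h.smul (-(if (1 : ℝ) ≤ r then (1 : ℝ) else -1))).congr ?_
  filter_upwards [ae_restrict_mem measurableSet_Ioi] with l hl
  have h1 := intervalIntegral_gaussian_kernel b r hl
  rw [intervalIntegral.intervalIntegral_eq_integral_uIoc] at h1
  simp only [Pi.smul_apply, neg_smul]
  rw [h1, neg_neg]

/-- The difference of exponentials is an integral over `ρ` between `1` and `r`; exchanging the order
turns the `l`-integral into a Gamma factor times `ρ^(-b - 1)`. -/
lemma integral_rpow_mul_exp_sub_exp (hb : -2 < b) (hr : 0 < r) :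
    ∫ l in Ioi (0 : ℝ), l ^ (b / 2 - 1) *
      (Real.exp (-(Real.pi * r ^ 2 * l)) - Real.exp (-(Real.pi * l))) =
      -(2 * Real.pi ^ (-(b / 2)) * Real.Gamma (b / 2 + 1)) * powPrimitive b r := by
  have hpos : ∀ ρ ∈ uIoc 1 r, 0 < ρ := fun ρ hρ => lt_of_le_of_lt (le_min one_pos.le hr.le) hρ.1
  have h := integral_integral_swap (f := fun l ρ : ℝ =>
    2 * Real.pi * ρ * (l ^ (b / 2) * Real.exp (-(Real.pi * ρ ^ 2 * l)))) (integrable_prod_gaussian_kernel hb hr)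
  have h2 : ∫ ρ in uIoc 1 r, ∫ l in Ioi (0 : ℝ),
      2 * Real.pi * ρ * (l ^ (b / 2) * Real.exp (-(Real.pi * ρ ^ 2 * l))) =
      2 * Real.pi ^ (-(b / 2)) * Real.Gamma (b / 2 + 1) * ∫ ρ in uIoc 1 r, ρ ^ (-b - 1) := by
    rw [← integral_const_mul]
    exact setIntegral_congr_fun measurableSet_uIoc fun ρ hρ =>
      integral_gaussian_kernel hb (hpos ρ hρ)
  rw [h2] at h
  rw [← integral_rpow_uIoc b hr, intervalIntegral.intervalIntegral_eq_integral_uIoc, neg_mul,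
    mul_smul_comm, ← h, ← integral_smul, ← integral_neg]
  refine setIntegral_congr_fun measurableSet_Ioi fun l hl => ?_
  have h1 := intervalIntegral_gaussian_kernel b r hl
  rw [intervalIntegral.intervalIntegral_eq_integral_uIoc] at h1
  rw [h1, neg_neg]

/-- For fixed `r` the integrand has constant sign in `l`, so the absolute value passes outside. This
is the majorant needed for Fubini. -/
lemma integral_abs_rpow_mul_exp_sub_exp (hb : -2 < b) (hr : 0 < r) :
    ∫ l in Ioi (0 : ℝ), |l ^ (b / 2 - 1) *
      (Real.exp (-(Real.pi * r ^ 2 * l)) - Real.exp (-(Real.pi * l)))| =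
      2 * Real.pi ^ (-(b / 2)) * Real.Gamma (b / 2 + 1) * |powPrimitive b r| := by
  have hC : 0 < 2 * Real.pi ^ (-(b / 2)) * Real.Gamma (b / 2 + 1) := by
    have := Real.Gamma_pos_of_pos (by linarith : 0 < b / 2 + 1)
    positivity
  have key : ∀ f : ℝ → ℝ, ((∀ l ∈ Ioi (0 : ℝ), 0 ≤ f l) ∨ ∀ l ∈ Ioi (0 : ℝ), f l ≤ 0) →
      ∫ l in Ioi (0 : ℝ), |f l| = |∫ l in Ioi (0 : ℝ), f l| := by
    rintro f (h | h)
    · rw [setIntegral_congr_fun measurableSet_Ioi fun l hl => abs_of_nonneg (h l hl),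
        abs_of_nonneg (setIntegral_nonneg measurableSet_Ioi h)]
    · rw [setIntegral_congr_fun measurableSet_Ioi fun l hl => abs_of_nonpos (h l hl),
        abs_of_nonpos (setIntegral_nonpos measurableSet_Ioi h), integral_neg]
  rw [key, integral_rpow_mul_exp_sub_exp hb hr, abs_mul, abs_neg, abs_of_pos hC]
  rcases le_total r 1 with h | h
  · left
    intro l hl
    have hl : 0 < l := hl
    refine mul_nonneg (by positivity) (sub_nonneg.2 (Real.exp_le_exp.2 (neg_le_neg ?_)))
    have : r ^ 2 ≤ 1 := pow_le_one₀ hr.le h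
    have : Real.pi * r ^ 2 ≤ Real.pi * 1 := by gcongr
    nlinarith
  · right
    intro l hl
    have hl : 0 < l := hl
    refine mul_nonpos_of_nonneg_of_nonpos (by positivity)
      (sub_nonpos.2 (Real.exp_le_exp.2 (neg_le_neg ?_)))
    have : 1 ≤ r ^ 2 := one_le_pow₀ h
    have : Real.pi * 1 ≤ Real.pi * r ^ 2 := by gcongr
    nlinarith

end Frullani

lemma nontrivial_space (hN : 1 ≤ N) : Nontrivial (Space N) :=
  Module.nontrivial_of_finrank_pos (R := ℝ) (by simp; omega)

lemma ae_ne_zero (hN : 1 ≤ N) : ∀ᵐ x : Space N, x ≠ 0 := by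
  have := nontrivial_space hN
  exact Measure.ae_ne volume 0

/-! ### Tempered functions -/

/-- In polar coordinates `d < N` settles the origin, and a weight of degree `k > N - d` settles
infinity. -/
lemma isTemperedFun_norm_rpow (hN : 1 ≤ N) {d : ℝ} (hd : d < N) :
    IsTemperedFun (fun x : Space N => ‖x‖ ^ (-d)) := by
  have := nontrivial_space hN
  obtain ⟨k, hk⟩ := exists_nat_gt (N - d)
  refine ⟨k, ?_⟩
  refine (integrable_fun_norm_addHaar (volume : Measure (Space N))
    (f := fun y => ((1 + y) ^ k)⁻¹ * y ^ (-d))).2 ?_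
  rw [finrank_euclideanSpace_fin, ← Ioc_union_Ioi_eq_Ioi (zero_le_one' ℝ)]
  have hmeas : Measurable (fun y : ℝ => y ^ (N - 1) • (((1 + y) ^ k)⁻¹ * y ^ (-d))) := by
    fun_prop
  have hpow : ∀ y : ℝ, 0 < y → y ^ (N - 1) * y ^ (-d) = y ^ ((N : ℝ) - 1 - d) := by
    intro y hy
    rw [← Real.rpow_natCast, ← Real.rpow_add hy, Nat.cast_sub hN]
    push_cast; ring_nf
  refine IntegrableOn.union ?_ ?_
  · have h : IntegrableOn (fun y : ℝ => y ^ ((N : ℝ) - 1 - d)) (Ioc 0 1) :=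
      (intervalIntegrable_iff_integrableOn_Ioc_of_le zero_le_one).1
        (intervalIntegral.intervalIntegrable_rpow' (by linarith))
    refine h.mono' hmeas.aestronglyMeasurable ?_
    filter_upwards [ae_restrict_mem measurableSet_Ioc] with y hy
    have hy0 : 0 < y := hy.1
    rw [Real.norm_of_nonneg (by positivity), ← hpow y hy0, smul_eq_mul]
    gcongr
    refine mul_le_of_le_one_left (by positivity) (inv_le_one_of_one_le₀ (one_le_pow₀ (by linarith)))
  · have h : IntegrableOn (fun y : ℝ => y ^ ((N : ℝ) - 1 - d - k)) (Ioi 1) :=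
      integrableOn_Ioi_rpow_of_lt (by linarith) one_pos
    refine h.mono' hmeas.aestronglyMeasurable ?_
    filter_upwards [ae_restrict_mem measurableSet_Ioi] with y hy
    have hy0 : 0 < y := one_pos.trans hy
    rw [Real.norm_of_nonneg (by positivity), Real.rpow_sub hy0, ← hpow y hy0, smul_eq_mul,
      Real.rpow_natCast, div_eq_inv_mul, mul_left_comm]
    gcongr
    linarith

lemma IsTemperedFun.const_mul {f : Space N → ℝ} (hf : IsTemperedFun f) (c : ℝ) :
    IsTemperedFun (fun x => c * f x) := by
  obtain ⟨k, hk⟩ := hf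
  exact ⟨k, (hk.const_mul c).congr (Eventually.of_forall fun x => by ring)⟩

lemma IsTemperedFun.mono {f g : Space N → ℝ} (hf : IsTemperedFun f)
    (hg : AEStronglyMeasurable g) (h : ∀ᵐ x, |g x| ≤ |f x|) : IsTemperedFun g := by
  obtain ⟨k, hk⟩ := hf
  refine ⟨k, hk.mono (Measurable.aestronglyMeasurable (by fun_prop) |>.mul hg) ?_⟩
  filter_upwards [h] with x hx
  rw [norm_mul, norm_mul]
  exact mul_le_mul_of_nonneg_left hx (norm_nonneg _)

lemma IsTemperedFun.add {f g : Space N → ℝ} (hf : IsTemperedFun f) (hg : IsTemperedFun g) :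
    IsTemperedFun (fun x => f x + g x) := by
  obtain ⟨k, hk⟩ := hf
  obtain ⟨l, hl⟩ := hg
  have key : ∀ (h : Space N → ℝ) (i j : ℕ), Integrable (fun x => ((1 + ‖x‖) ^ i)⁻¹ * h x) →
      Integrable (fun x => ((1 + ‖x‖) ^ (i + j))⁻¹ * h x) := by
    intro h i j hi
    have := hi.bdd_mul (f := fun x : Space N => ((1 + ‖x‖) ^ j)⁻¹) (c := 1)
      (Measurable.aestronglyMeasurable (by fun_prop)) (Eventually.of_forall fun x => by
        rw [Real.norm_of_nonneg (by positivity)]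
        exact inv_le_one_of_one_le₀ (one_le_pow₀ (by linarith [norm_nonneg x])))
    refine this.congr (Eventually.of_forall fun x => ?_)
    simp only [pow_add, mul_inv]
    ring
  refine ⟨k + l, ((key f k l hk).add (add_comm l k ▸ key g l k hl)).congr
    (Eventually.of_forall fun x => ?_)⟩
  simp only [Pi.add_apply]
  ring

lemma eq_one_add_norm_pow_mul {f : Space N → ℝ} (k : ℕ) :
    f = fun x => (1 + ‖x‖) ^ k * (((1 + ‖x‖) ^ k)⁻¹ * f x) := by
  ext x
  rw [mul_inv_cancel_left₀]
  positivity

lemma IsTemperedFun.locallyIntegrable {f : Space N → ℝ} (hf : IsTemperedFun f) :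
    LocallyIntegrable f := by
  obtain ⟨k, hk⟩ := hf
  rw [eq_one_add_norm_pow_mul (f := f) k]
  exact hk.locallyIntegrable.continuous_smul (g := fun x : Space N => (1 + ‖x‖) ^ k) (by fun_prop)

lemma IsTemperedFun.integrable_mul {f : Space N → ℝ} (hf : IsTemperedFun f)
    (φ : 𝓢(Space N, ℂ)) : Integrable (fun x => (f x : ℂ) * φ x) := by
  obtain ⟨k, hk⟩ := hf
  have h := hk.ofReal (𝕜 := ℂ) |>.mul_bdd (g := fun x => (((1 + ‖x‖) ^ k : ℝ) : ℂ) * φ x)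
    (c := 2 ^ k * ((Finset.Iic (k, 0)).sup fun m => SchwartzMap.seminorm ℝ m.1 m.2) φ)
    (Continuous.aestronglyMeasurable (by fun_prop)) (Eventually.of_forall fun x => by
      have := SchwartzMap.one_add_le_sup_seminorm_apply (𝕜 := ℝ) (m := (k, 0)) le_rfl le_rfl φ x
      rw [norm_iteratedFDeriv_zero] at this
      rw [norm_mul, Complex.norm_real, Real.norm_of_nonneg (by positivity)]
      exact this)
  refine h.congr (Eventually.of_forall fun x => ?_)
  conv_rhs => rw [eq_one_add_norm_pow_mul (f := f) k]
  simp only [RCLike.ofReal_mul, Complex.ofReal_mul, Complex.coe_algebraMap]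
  simp
  ring

/-! ### Gaussians and Mellin transforms -/

/-- The Fourier transform is symmetric under the integral pairing, and it sends a Gaussian of
parameter `l⁻¹` to one of parameter `l`. -/
lemma integral_gaussian_mul (φ : 𝓢(Space N, ℂ)) {l : ℝ} (hl : 0 < l) :
    ∫ x : Space N, ((Real.exp (-(Real.pi * ‖x‖ ^ 2 * l)) : ℝ) : ℂ) * φ x =
      ((l ^ (-((N : ℝ) / 2)) : ℝ) : ℂ) *
        ∫ ξ : Space N, ((Real.exp (-(Real.pi * ‖ξ‖ ^ 2 * l⁻¹)) : ℝ) : ℂ) *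
          𝓕 (φ : Space N → ℂ) ξ := by
  set c : ℂ := ((Real.pi * l⁻¹ : ℝ) : ℂ) with hc
  have hc0 : 0 < c.re := by rw [hc, Complex.ofReal_re]; have := Real.pi_pos; positivity
  have hg : Integrable (fun ξ : Space N => Complex.exp (-c * ‖ξ‖ ^ 2)) := by
    simpa using GaussianFourier.integrable_cexp_neg_mul_sq_norm_add hc0 0 (0 : Space N)
  have h : ∫ ξ, 𝓕 (φ : Space N → ℂ) ξ • Complex.exp (-c * ‖ξ‖ ^ 2) =
      ∫ x, φ x • 𝓕 (fun ξ : Space N => Complex.exp (-c * ‖ξ‖ ^ 2)) x := by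
    simpa using! VectorFourier.integral_fourierIntegral_smul_eq_flip (L := innerₗ (Space N))
      Real.continuous_fourierChar continuous_inner φ.integrable hg
  have hpi : Real.pi / (Real.pi * l⁻¹) = l := by
    have := Real.pi_pos.ne'
    field_simp
  have h2 : ∀ x : Space N, 𝓕 (fun ξ : Space N => Complex.exp (-c * ‖ξ‖ ^ 2)) x =
      ((l ^ ((N : ℝ) / 2) : ℝ) : ℂ) * ((Real.exp (-(Real.pi * ‖x‖ ^ 2 * l)) : ℝ) : ℂ) := by
    intro x
    rw [fourier_gaussian_innerProductSpace hc0, finrank_euclideanSpace_fin, hc,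
      ← Complex.ofReal_div, hpi, Complex.ofReal_cpow hl.le, Complex.ofReal_exp]
    congr 2
    · push_cast; rfl
    · have hp : (Real.pi : ℂ) ≠ 0 := by exact_mod_cast Real.pi_pos.ne'
      have hl' : (l : ℂ) ≠ 0 := by exact_mod_cast hl.ne'
      push_cast
      field_simp
  simp only [h2, smul_eq_mul] at h
  have h3 : ∀ x : Space N, ((Real.exp (-(Real.pi * ‖x‖ ^ 2 * l⁻¹)) : ℝ) : ℂ) =
      Complex.exp (-c * ‖x‖ ^ 2) := by
    intro x
    rw [Complex.ofReal_exp, hc]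
    congr 1
    push_cast; ring
  simp only [h3]
  simp only [mul_comm (Complex.exp _)]
  rw [h, ← integral_const_mul]
  refine integral_congr_ae (Eventually.of_forall fun x => ?_)
  have h4 : ((l ^ (-((N : ℝ) / 2)) : ℝ) : ℂ) * ((l ^ ((N : ℝ) / 2) : ℝ) : ℂ) = 1 := by
    rw [← Complex.ofReal_mul, ← Real.rpow_add hl]; simp
  simp only
  linear_combination (-(((Real.exp (-(Real.pi * ‖x‖ ^ 2 * l)) : ℝ) : ℂ) * φ x)) * h4

/-- Fubini for a real kernel `k l x` with known integrals over `l ∈ (0, ∞)`. -/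
lemma integral_kernel_swap {k : ℝ → Space N → ℝ} (hk : Measurable (Function.uncurry k))
    {W V : Space N → ℝ} (hint : ∀ᵐ x, IntegrableOn (fun l => k l x) (Ioi 0))
    (hV : ∀ᵐ x, ∫ l in Ioi (0 : ℝ), |k l x| = V x)
    (hW : ∀ᵐ x, ∫ l in Ioi (0 : ℝ), k l x = W x)
    {g : Space N → ℂ} (hg : AEStronglyMeasurable g) (hVg : Integrable (fun x => (V x : ℂ) * g x)) :
    ∫ x, (W x : ℂ) * g x = ∫ l in Ioi (0 : ℝ), ∫ x, (k l x : ℂ) * g x := by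
  have hprod : Integrable (Function.uncurry fun (l : ℝ) (x : Space N) => (k l x : ℂ) * g x)
      ((volume.restrict (Ioi (0 : ℝ))).prod volume) := by
    rw [integrable_prod_iff']
    · constructor
      · filter_upwards [hint] with x hx
        exact hx.ofReal (𝕜 := ℂ) |>.mul_const (g x)
      · refine hVg.norm.congr ?_
        filter_upwards [hV] with x hx
        have h0 : 0 ≤ V x := hx ▸ integral_nonneg fun l => abs_nonneg _
        simp only [Function.uncurry_apply_pair, norm_mul, Complex.norm_real, Real.norm_eq_abs]
        rw [integral_mul_const, hx, abs_of_nonneg h0]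
    · exact (Complex.measurable_ofReal.comp hk).aestronglyMeasurable.mul hg.comp_snd
  rw [integral_integral_swap hprod]
  refine integral_congr_ae ?_
  filter_upwards [hW] with x hx
  rw [integral_mul_const, ← hx, integral_complex_ofReal]

/-- The substitution `l ↦ l⁻¹` reduces this to the Gamma integral. -/
lemma integral_rpow_mul_exp_neg_inv {d c : ℝ} (hd : 0 < d) (hc : 0 < c) :
    IntegrableOn (fun l : ℝ => l ^ (-d - 1) * Real.exp (-(c * l⁻¹))) (Ioi 0) ∧
    ∫ l in Ioi (0 : ℝ), l ^ (-d - 1) * Real.exp (-(c * l⁻¹)) = c ^ (-d) * Real.Gamma d := by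
  have key : EqOn (fun l : ℝ => (|(-1 : ℝ)| * l ^ ((-1 : ℝ) - 1)) •
      (fun l => l ^ (d - 1) * Real.exp (-(c * l))) (l ^ (-1 : ℝ)))
      (fun l : ℝ => l ^ (-d - 1) * Real.exp (-(c * l⁻¹))) (Ioi 0) := by
    intro l hl
    have hl : 0 < l := hl
    simp only [abs_neg, abs_one, one_mul, smul_eq_mul]
    rw [← Real.rpow_mul hl.le, ← mul_assoc, ← Real.rpow_add hl, Real.rpow_neg_one]
    ring_nf
  constructor
  · exact ((integrableOn_Ioi_comp_rpow_iff _ (by norm_num : (-1 : ℝ) ≠ 0)).2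
      (integrableOn_rpow_mul_exp_neg_mul hd hc)).congr_fun key measurableSet_Ioi
  · rw [← setIntegral_congr_fun measurableSet_Ioi key,
      integral_comp_rpow_Ioi (fun l => l ^ (d - 1) * Real.exp (-(c * l))) (by norm_num : (-1 : ℝ) ≠ 0),
      Real.integral_rpow_mul_exp_neg_mul_Ioi hd hc, one_div, Real.inv_rpow hc.le,
      Real.rpow_neg hc.le]

lemma integral_ofReal_const_mul (c : ℝ) (f : Space N → ℝ) (g : Space N → ℂ) :
    ∫ x, ((c * f x : ℝ) : ℂ) * g x = (c : ℂ) * ∫ x, (f x : ℂ) * g x := by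
  simp only [Complex.ofReal_mul, mul_assoc, integral_const_mul]

lemma rpow_pi_mul_sq (d : ℝ) (r : ℝ) (hr : 0 ≤ r) :
    (Real.pi * r ^ 2) ^ (-(d / 2)) = Real.pi ^ (-(d / 2)) * r ^ (-d) := by
  rw [Real.mul_rpow Real.pi_pos.le (by positivity), ← Real.rpow_natCast, ← Real.rpow_mul hr]
  push_cast; ring_nf

/-- The Mellin transform of the Gaussian means of `φ` as an integral of `𝓕 φ`. -/
lemma integral_mellin_gaussian (hN : 1 ≤ N) {d : ℝ} (hd : 0 < d) (φ : 𝓢(Space N, ℂ))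
    (hφ : Integrable (fun ξ => ((‖ξ‖ ^ (-d) : ℝ) : ℂ) * 𝓕 (φ : Space N → ℂ) ξ)) :
    ∫ l in Ioi (0 : ℝ), ∫ x : Space N,
        ((l ^ (((N : ℝ) - d) / 2 - 1) * Real.exp (-(Real.pi * ‖x‖ ^ 2 * l)) : ℝ) : ℂ) * φ x =
      ((Real.pi ^ (-(d / 2)) * Real.Gamma (d / 2) : ℝ) : ℂ) *
        ∫ ξ, ((‖ξ‖ ^ (-d) : ℝ) : ℂ) * 𝓕 (φ : Space N → ℂ) ξ := by
  have hG := Real.Gamma_pos_of_pos (half_pos hd)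
  have hae := ae_ne_zero hN
  have h := integral_kernel_swap (N := N)
    (k := fun l ξ => l ^ (-(d / 2) - 1) * Real.exp (-(Real.pi * ‖ξ‖ ^ 2 * l⁻¹)))
    (V := fun ξ => Real.pi ^ (-(d / 2)) * Real.Gamma (d / 2) * ‖ξ‖ ^ (-d))
    (W := fun ξ => Real.pi ^ (-(d / 2)) * Real.Gamma (d / 2) * ‖ξ‖ ^ (-d))
    (g := 𝓕 (φ : Space N → ℂ)) (by unfold Function.uncurry; fun_prop) ?_ ?_ ?_ ?_ ?_
  · rw [← integral_ofReal_const_mul, h]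
    refine setIntegral_congr_fun measurableSet_Ioi fun l hl => ?_
    have hl : 0 < l := hl
    rw [integral_ofReal_const_mul, integral_ofReal_const_mul, integral_gaussian_mul φ hl, ← mul_assoc, ← Complex.ofReal_mul, ← Real.rpow_add hl]
    congr 3
    ring
  · filter_upwards [hae] with ξ hξ
    have h0 : 0 < ‖ξ‖ := norm_pos_iff.2 hξ
    exact (integral_rpow_mul_exp_neg_inv (half_pos hd) (by positivity)).1
  · filter_upwards [hae] with ξ hξ
    have h0 : 0 < ‖ξ‖ := norm_pos_iff.2 hξ
    rw [mul_right_comm, ← rpow_pi_mul_sq d _ h0.le,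
      ← (integral_rpow_mul_exp_neg_inv (half_pos hd) (by positivity)).2]
    refine setIntegral_congr_fun measurableSet_Ioi fun l hl => abs_of_nonneg ?_
    have hl : 0 < l := hl
    positivity
  · filter_upwards [hae] with ξ hξ
    have h0 : 0 < ‖ξ‖ := norm_pos_iff.2 hξ
    rw [mul_right_comm, ← rpow_pi_mul_sq d _ h0.le,
      ← (integral_rpow_mul_exp_neg_inv (half_pos hd) (by positivity)).2]
  · exact (𝓕 φ).continuous.aestronglyMeasurable
  · refine (hφ.const_mul ((Real.pi ^ (-(d / 2)) * Real.Gamma (d / 2) : ℝ) : ℂ)).congr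
      (Eventually.of_forall fun ξ => ?_)
    push_cast; ring

/-- The Fourier transform of the Riesz potential `‖x‖ ^ (-a)`. -/
lemma integral_norm_rpow_mul (hN : 1 ≤ N) {a : ℝ} (ha : 0 < a) (haN : a < N)
    (ψ : 𝓢(Space N, ℂ)) :
    ((Real.pi ^ (-(a / 2)) * Real.Gamma (a / 2) : ℝ) : ℂ) *
        ∫ x, ((‖x‖ ^ (-a) : ℝ) : ℂ) * ψ x =
      ((Real.pi ^ (-((N - a) / 2)) * Real.Gamma ((N - a) / 2) : ℝ) : ℂ) *
        ∫ ξ, ((‖ξ‖ ^ (-(N - a)) : ℝ) : ℂ) * 𝓕 (ψ : Space N → ℂ) ξ := by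
  have hG := Real.Gamma_pos_of_pos (half_pos ha)
  have hae := ae_ne_zero hN
  rw [← integral_mellin_gaussian hN (sub_pos.2 haN) ψ
    ((isTemperedFun_norm_rpow hN (by linarith)).integrable_mul (𝓕 ψ)), sub_sub_cancel]
  have hkey : ∀ x : Space N, x ≠ 0 → ∫ l in Ioi (0 : ℝ),
      l ^ (a / 2 - 1) * Real.exp (-(Real.pi * ‖x‖ ^ 2 * l)) =
      Real.pi ^ (-(a / 2)) * Real.Gamma (a / 2) * ‖x‖ ^ (-a) := by
    intro x hx
    have h0 : 0 < ‖x‖ := norm_pos_iff.2 hx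
    rw [mul_right_comm, ← rpow_pi_mul_sq a _ h0.le, Real.integral_rpow_mul_exp_neg_mul_Ioi
      (half_pos ha) (by positivity), one_div, Real.inv_rpow (by positivity),
      Real.rpow_neg (by positivity)]
  have h := integral_kernel_swap (N := N)
    (k := fun l x => l ^ (a / 2 - 1) * Real.exp (-(Real.pi * ‖x‖ ^ 2 * l)))
    (V := fun x => Real.pi ^ (-(a / 2)) * Real.Gamma (a / 2) * ‖x‖ ^ (-a))
    (W := fun x => Real.pi ^ (-(a / 2)) * Real.Gamma (a / 2) * ‖x‖ ^ (-a))
    (g := ψ) (by unfold Function.uncurry; fun_prop) ?_ ?_ ?_ ψ.continuous.aestronglyMeasurable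
    (((isTemperedFun_norm_rpow hN haN).const_mul _).integrable_mul ψ)
  · rw [← h, integral_ofReal_const_mul]
  · filter_upwards [hae] with x hx
    have h0 : 0 < ‖x‖ := norm_pos_iff.2 hx
    exact integrableOn_rpow_mul_exp_neg_mul (half_pos ha) (by positivity)
  · filter_upwards [hae] with x hx
    rw [← hkey x hx]
    refine setIntegral_congr_fun measurableSet_Ioi fun l hl => abs_of_nonneg ?_
    have hl : 0 < l := hl
    positivity
  · filter_upwards [hae] with x hx using hkey x hx

/-! ### The fractional potential of a power of the norm. -/

lemma isTemperedFun_powPrimitive_norm (hN : 1 ≤ N) {b : ℝ} (hb : b < N) (hb2 : -2 < b) :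
    IsTemperedFun (fun x : Space N => powPrimitive b ‖x‖) := by
  obtain ⟨δ, γ, C, hδ, hγ, -, -, h⟩ := abs_powPrimitive_le (by exact_mod_cast hN) hb hb2
  refine IsTemperedFun.mono (((isTemperedFun_norm_rpow hN hδ).add
    (isTemperedFun_norm_rpow hN (d := -γ) (by linarith [(Nat.cast_nonneg N : (0 : ℝ) ≤ N)]))).const_mul C)
    ((measurable_powPrimitive b).comp measurable_norm).aestronglyMeasurable ?_
  filter_upwards [ae_ne_zero hN] with x hx
  rw [neg_neg]
  exact (h _ (norm_pos_iff.2 hx)).trans (le_abs_self _)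

lemma isLittleO_powPrimitive (b : ℝ) (hb2 : -2 < b) :
    powPrimitive b =o[atTop] fun r : ℝ => r ^ 2 := by
  obtain ⟨δ, γ, C, -, hγ, hγ2, hδ, h⟩ :=
    abs_powPrimitive_le (n := max b 0 + 1) (by positivity) (by linarith [le_max_left b 0]) hb2
  have h1 : powPrimitive b =O[atTop] fun r : ℝ => r ^ γ := by
    refine IsBigO.of_bound (|C| * 2) ?_
    filter_upwards [eventually_ge_atTop 1] with r hr
    have hr0 : 0 < r := by linarith
    have h2 : r ^ (-δ) ≤ r ^ γ := Real.rpow_le_rpow_of_exponent_le hr (by linarith)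
    have h3 : 0 < r ^ (-δ) := by positivity
    rw [Real.norm_eq_abs, Real.norm_of_nonneg (by positivity)]
    calc _ ≤ C * (r ^ (-δ) + r ^ γ) := h r hr0
      _ ≤ |C| * (r ^ (-δ) + r ^ γ) := by gcongr; exact le_abs_self C
      _ ≤ |C| * (r ^ γ + r ^ γ) := by gcongr
      _ = _ := by ring
  refine h1.trans_isLittleO ?_
  refine (isLittleO_iff_tendsto' ?_).2 ((tendsto_rpow_neg_atTop (sub_pos.2 hγ2)).congr' ?_)
  · filter_upwards [eventually_gt_atTop 0] with r hr h0
    exact absurd h0 (by positivity)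
  · filter_upwards [eventually_gt_atTop 0] with r hr
    rw [neg_sub, Real.rpow_sub hr, Real.rpow_two]

/-- The integral is the Fourier transform at `0`, where the symbol vanishes. -/
lemma IsFracLaplacianOf.integral_eq_zero {s : ℝ} (hs : 0 < s) {φ ψ : 𝓢(Space N, ℂ)}
    (h : IsFracLaplacianOf s φ ψ) : ∫ x, φ x = 0 := by
  have h0 := h 0
  rw [norm_zero, mul_zero, Real.zero_rpow (by positivity), Complex.ofReal_zero, zero_mul,
    Real.fourier_eq] at h0
  simpa using h0

/-- This continues the Riesz potential formula to `-2 < b ≤ 0`. There `‖ξ‖^(-(N - b))` is not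
locally integrable, so the decay of `𝓕 φ` at the origin must be assumed through `hφ`. -/
lemma integral_powPrimitive_mul (hN : 1 ≤ N) {b : ℝ} (hb : b < N) (hb2 : -2 < b)
    (φ : 𝓢(Space N, ℂ)) (hφ0 : ∫ x, φ x = 0)
    (hφ : Integrable (fun ξ => ((‖ξ‖ ^ (-(N - b)) : ℝ) : ℂ) * 𝓕 (φ : Space N → ℂ) ξ)) :
    ((-(2 * Real.pi ^ (-(b / 2)) * Real.Gamma (b / 2 + 1)) : ℝ) : ℂ) *
        ∫ x, (powPrimitive b ‖x‖ : ℂ) * φ x =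
      ((Real.pi ^ (-((N - b) / 2)) * Real.Gamma ((N - b) / 2) : ℝ) : ℂ) *
        ∫ ξ, ((‖ξ‖ ^ (-(N - b)) : ℝ) : ℂ) * 𝓕 (φ : Space N → ℂ) ξ := by
  have hae := ae_ne_zero hN
  have htemp := isTemperedFun_powPrimitive_norm hN hb hb2
  rw [← integral_mellin_gaussian hN (sub_pos.2 hb) φ hφ, sub_sub_cancel,
    ← integral_ofReal_const_mul]
  rw [integral_kernel_swap (N := N)
    (k := fun l x => l ^ (b / 2 - 1) *
      (Real.exp (-(Real.pi * ‖x‖ ^ 2 * l)) - Real.exp (-(Real.pi * l))))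
    (V := fun x => 2 * Real.pi ^ (-(b / 2)) * Real.Gamma (b / 2 + 1) * |powPrimitive b ‖x‖|)
    (g := φ) (by unfold Function.uncurry; fun_prop) ?_ ?_ ?_ φ.continuous.aestronglyMeasurable ?_]
  · refine setIntegral_congr_fun measurableSet_Ioi fun l hl => ?_
    have hl : 0 < l := hl
    have hint : Integrable (fun x : Space N =>
        ((l ^ (b / 2 - 1) * Real.exp (-(Real.pi * ‖x‖ ^ 2 * l)) : ℝ) : ℂ) * φ x) := by
      refine φ.integrable.bdd_mul (c := l ^ (b / 2 - 1))
        (Continuous.aestronglyMeasurable (by fun_prop)) (Eventually.of_forall fun x => ?_)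
      rw [Complex.norm_real, Real.norm_of_nonneg (by positivity)]
      refine mul_le_of_le_one_right (by positivity) (Real.exp_le_one_iff.2 ?_)
      have := Real.pi_pos
      simp only [Left.neg_nonpos_iff]
      positivity
    have h2 : Integrable (fun x : Space N =>
        ((l ^ (b / 2 - 1) * Real.exp (-(Real.pi * l)) : ℝ) : ℂ) * φ x) := φ.integrable.const_mul _
    -- The zero is rewritten as `l^(b/2 - 1) e^(-π l) ∫ φ`, which supplies the regularizing term.
    rw [← sub_zero (∫ x : Space N,
      ((l ^ (b / 2 - 1) * Real.exp (-(Real.pi * ‖x‖ ^ 2 * l)) : ℝ) : ℂ) * φ x)]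
    rw [← mul_zero ((l ^ (b / 2 - 1) * Real.exp (-(Real.pi * l)) : ℝ) : ℂ), ← hφ0,
      ← integral_const_mul, ← integral_sub hint h2]
    refine integral_congr_ae (Eventually.of_forall fun x => ?_)
    push_cast; ring
  · filter_upwards [hae] with x hx
    exact integrableOn_rpow_mul_exp_sub_exp hb2 (norm_pos_iff.2 hx)
  · filter_upwards [hae] with x hx
    exact integral_abs_rpow_mul_exp_sub_exp hb2 (norm_pos_iff.2 hx)
  · filter_upwards [hae] with x hx
    exact integral_rpow_mul_exp_sub_exp hb2 (norm_pos_iff.2 hx)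
  · refine IsTemperedFun.integrable_mul (IsTemperedFun.const_mul (htemp.mono ?_ ?_) _) φ
    · exact ((measurable_powPrimitive b).comp measurable_norm).abs.aestronglyMeasurable
    · exact Eventually.of_forall fun x => (abs_abs _).le

/-- The fractional potential of `‖x‖ ^ (-a)`, by pairing with test functions. -/
lemma exists_integral_powPrimitive_mul_eq (hN : 1 ≤ N) {a s : ℝ} (ha : 0 < a) (haN : a < N)
    (hs0 : 0 < s) (hs1 : s < 1) :
    ∃ κ : ℝ, 0 < κ ∧ ∀ φ ψ : 𝓢(Space N, ℂ), IsFracLaplacianOf s φ ψ →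
      ∫ x, ((-κ * powPrimitive (a - 2 * s) ‖x‖ : ℝ) : ℂ) * φ x =
        ∫ x, ((‖x‖ ^ (-a) : ℝ) : ℂ) * ψ x := by
  set b := a - 2 * s with hb
  have hG1 := Real.Gamma_pos_of_pos (by linarith : 0 < b / 2 + 1)
  have hG2 := Real.Gamma_pos_of_pos (by linarith : 0 < (N - b) / 2)
  have hG3 := Real.Gamma_pos_of_pos (by linarith : 0 < (N - a) / 2)
  have hG4 := Real.Gamma_pos_of_pos (half_pos ha)
  set C := 2 * Real.pi ^ (-(b / 2)) * Real.Gamma (b / 2 + 1)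
  set A := Real.pi ^ (-((N - b) / 2)) * Real.Gamma ((N - b) / 2)
  set A' := Real.pi ^ (-((N - a) / 2)) * Real.Gamma ((N - a) / 2)
  set B := Real.pi ^ (-(a / 2)) * Real.Gamma (a / 2)
  set D := (2 * Real.pi) ^ (2 * s)
  have hCp : 0 < C := by positivity
  have hAp : 0 < A := by positivity
  have hAp' : 0 < A' := by positivity
  have hBp : 0 < B := by positivity
  have hDp : 0 < D := by positivity
  -- Both pairings are multiples of `∫ ‖ξ‖^(-(N - a)) 𝓕 ψ`: the one with `φ` has factor `-(A * D) /
  -- C`, the one with `ψ` has factor `A' / B`. Their quotient gives `κ`.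
  refine ⟨C * A' / (B * (A * D)), by positivity, fun φ ψ h => ?_⟩
  have hae : ∀ᵐ ξ : Space N, ((‖ξ‖ ^ (-(N - b)) : ℝ) : ℂ) * 𝓕 (φ : Space N → ℂ) ξ =
      (D : ℂ) * (((‖ξ‖ ^ (-(N - a)) : ℝ) : ℂ) * 𝓕 (ψ : Space N → ℂ) ξ) := by
    filter_upwards [ae_ne_zero hN] with ξ hξ
    have h0 : 0 < ‖ξ‖ := norm_pos_iff.2 hξ
    rw [h ξ, Real.mul_rpow (by positivity) h0.le, ← mul_assoc, ← mul_assoc, ← Complex.ofReal_mul,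
      ← Complex.ofReal_mul, mul_left_comm, ← Real.rpow_add h0]
    congr 4
    rw [hb]; ring
  have hψ := (isTemperedFun_norm_rpow hN (d := N - a) (by linarith)).integrable_mul (𝓕 ψ)
  have h1 := integral_powPrimitive_mul hN (b := b) (by linarith) (by linarith) φ
    (h.integral_eq_zero hs0) ((hψ.const_mul (D : ℂ)).congr (hae.mono fun _ h => h.symm))
  have h2 := integral_norm_rpow_mul hN ha haN ψ
  rw [integral_congr_ae hae, integral_const_mul] at h1
  change ((-C : ℝ) : ℂ) * _ = (A : ℂ) * _ at h1
  change (B : ℂ) * _ = (A' : ℂ) * _ at h2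
  clear_value C A A' B D
  rw [integral_ofReal_const_mul]
  have hne : ∀ r : ℝ, 0 < r → (r : ℂ) ≠ 0 := fun r hr => by exact_mod_cast hr.ne'
  have hA := hne A hAp
  have hB := hne B hBp
  have hD := hne D hDp
  apply mul_left_cancel₀ hB
  rw [h2]
  have h3 : ∫ ξ, ((‖ξ‖ ^ (-(N - a)) : ℝ) : ℂ) * 𝓕 (ψ : Space N → ℂ) ξ =
      ((-C : ℝ) : ℂ) * (∫ x, (powPrimitive b ‖x‖ : ℂ) * φ x) / (A * D) := by
    rw [h1]; field_simp
  rw [h3]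
  push_cast
  field_simp

lemma exists_isInvFracLaplacian (hN : 1 ≤ N) {a s : ℝ} (ha : 0 < a) (haN : a < N)
    (hs0 : 0 < s) (hs1 : s < 1) :
    ∃ κ : ℝ, 0 < κ ∧ ∀ c : ℝ, IsInvFracLaplacian s (fun x : Space N => c * ‖x‖ ^ (-a))
      (fun x => c * (-κ * powPrimitive (a - 2 * s) ‖x‖)) := by
  obtain ⟨κ, hκ, h⟩ := exists_integral_powPrimitive_mul_eq hN ha haN hs0 hs1
  refine ⟨κ, hκ, fun c => ⟨?_, ?_, ?_, ?_, ?_⟩⟩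
  · exact (isTemperedFun_norm_rpow hN haN).const_mul c
  · exact ((isTemperedFun_powPrimitive_norm hN (by linarith) (by linarith)).const_mul _).const_mul c
  · intro φ ψ hφ
    rw [integral_ofReal_const_mul c, integral_ofReal_const_mul c, h φ ψ hφ]
  · exact (((isLittleO_powPrimitive (a - 2 * s) (by linarith)).comp_tendsto
      tendsto_norm_cobounded_atTop).const_mul_left _).const_mul_left c
  · intro R _ x
    rw [R.norm_map]

/-! ### Calculus of radial functions -/

lemma HasDerivAt.hasFDerivAt_comp_norm {g : ℝ → ℝ} {g' : ℝ} {x : Space N} (hx : x ≠ 0)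
    (hg : HasDerivAt g g' ‖x‖) :
    HasFDerivAt (fun y : Space N => g ‖y‖) ((g' * ‖x‖⁻¹) • innerSL ℝ x) x := by
  have h0 : 0 < ‖x‖ := norm_pos_iff.2 hx
  have h1 : HasFDerivAt (fun y : Space N => ‖y‖) (‖x‖⁻¹ • innerSL ℝ x) x := by
    have h := (hasStrictFDerivAt_norm_sq x).hasFDerivAt.sqrt (by positivity)
    simp only [Real.sqrt_sq (norm_nonneg _)] at h
    convert! h using 1
    ext y
    simp
    field_simp
  rw [mul_smul]
  exact hg.comp_hasFDerivAt x h1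

lemma hasFDerivAt_powPrimitive_norm (b : ℝ) {x : Space N} (hx : x ≠ 0) :
    HasFDerivAt (fun y : Space N => powPrimitive b ‖y‖) (‖x‖ ^ (-b - 2) • innerSL ℝ x) x := by
  have h0 : 0 < ‖x‖ := norm_pos_iff.2 hx
  convert! HasDerivAt.hasFDerivAt_comp_norm hx (hasDerivAt_powPrimitive b h0) using 2
  rw [← div_eq_mul_inv, ← Real.rpow_sub_one h0.ne']
  ring_nf

lemma hasFDerivAt_norm_rpow_neg (a : ℝ) {x : Space N} (hx : x ≠ 0) :
    HasFDerivAt (fun y : Space N => ‖y‖ ^ (-a)) ((-a * ‖x‖ ^ (-a - 2)) • innerSL ℝ x) x := by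
  have h0 : 0 < ‖x‖ := norm_pos_iff.2 hx
  convert! HasDerivAt.hasFDerivAt_comp_norm hx
    (Real.hasDerivAt_rpow_const (p := -a) (Or.inl h0.ne')) using 2
  rw [mul_assoc, ← div_eq_mul_inv, ← Real.rpow_sub_one h0.ne']
  ring_nf

lemma hasFDerivAt_norm_rpow_smul (c a : ℝ) {x : Space N} (hx : x ≠ 0) :
    HasFDerivAt (fun y : Space N => (c * ‖y‖ ^ (-a)) • y)
      ((c * ‖x‖ ^ (-a)) • ContinuousLinearMap.id ℝ (Space N) +
        (c • (-a * ‖x‖ ^ (-a - 2)) • innerSL ℝ x).smulRight x) x :=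
  ((hasFDerivAt_norm_rpow_neg a hx).const_mul c).smul (hasFDerivAt_id x)

/-- The identity part of the derivative has trace `N`; the rank-one part contributes `-a`, by
homogeneity. -/
lemma divergence_norm_rpow_smul (c a : ℝ) {x : Space N} (hx : x ≠ 0) :
    divergence (fun y : Space N => (c * ‖y‖ ^ (-a)) • y) x = c * (N - a) * ‖x‖ ^ (-a) := by
  have h0 : 0 < ‖x‖ := norm_pos_iff.2 hx
  have h1 : ‖x‖ ^ (-a - 2) * ‖x‖ ^ 2 = ‖x‖ ^ (-a) := by
    rw [← Real.rpow_two, ← Real.rpow_add h0]; ring_nf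
  rw [divergence, (hasFDerivAt_norm_rpow_smul c a hx).fderiv]
  have h2 : ∀ f : Space N →L[ℝ] ℝ, LinearMap.trace ℝ (Space N)
      (f.smulRight x : Space N →ₗ[ℝ] Space N) = f x := fun f =>
    LinearMap.trace_smulRight (f : Space N →ₗ[ℝ] ℝ) x
  rw [ContinuousLinearMap.toLinearMap_add, map_add, h2, ContinuousLinearMap.toLinearMap_smul,
    map_smul]
  have h3 : LinearMap.trace ℝ (Space N) (ContinuousLinearMap.id ℝ (Space N)) = N := by
    rw [ContinuousLinearMap.coe_id, LinearMap.trace_id, finrank_euclideanSpace_fin]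
  rw [h3]
  simp only [smul_apply, innerSL_apply_apply, real_inner_self_eq_norm_sq,
    smul_eq_mul]
  linear_combination (-(c * a)) * h1

/-! ### Scaling identity for homogeneous weights -/

lemma integral_norm_rpow_mul_comp_smul (hN : 1 ≤ N) (a : ℝ) (χ : Space N → ℝ) {l : ℝ}
    (hl : 0 < l) :
    ∫ x : Space N, ‖x‖ ^ (-a) * χ (l • x) = l ^ (a - N) * ∫ x : Space N, ‖x‖ ^ (-a) * χ x := by
  have h := Measure.integral_comp_smul (volume : Measure (Space N))
    (fun x => ‖x‖ ^ (-a) * χ x) l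
  rw [finrank_euclideanSpace_fin, abs_of_pos (by positivity), smul_eq_mul] at h
  have h2 : l ^ (a - N) = l ^ a * (l ^ N)⁻¹ := by
    rw [Real.rpow_sub hl, Real.rpow_natCast, div_eq_mul_inv]
  rw [h2, mul_assoc, ← h, ← integral_const_mul]
  refine integral_congr_ae ?_
  filter_upwards [ae_ne_zero hN] with x hx
  rw [norm_smul, Real.norm_of_nonneg hl.le, Real.mul_rpow hl.le (norm_nonneg _), ← mul_assoc,
    ← mul_assoc, ← Real.rpow_add hl, add_neg_cancel, Real.rpow_zero, one_mul]

/-- Integration by parts against the Euler field for the weight `‖x‖ ^ (-a)`. -/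
lemma integral_norm_rpow_mul_fderiv_self (hN : 1 ≤ N) {a : ℝ} (haN : a < N)
    {χ : Space N → ℝ} (hχ : ContDiff ℝ 1 χ) (hc : HasCompactSupport χ) :
    ∫ x : Space N, ‖x‖ ^ (-a) * fderiv ℝ χ x x = -((N - a) * ∫ x : Space N, ‖x‖ ^ (-a) * χ x) := by
  have hloc := (isTemperedFun_norm_rpow hN haN).locallyIntegrable
  have hd : Continuous (fderiv ℝ χ) := hχ.continuous_fderiv one_ne_zero
  obtain ⟨M, hM⟩ := hd.bounded_above_of_compact_support (hc.fderiv ℝ)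
  obtain ⟨R, hR⟩ := (hc.fderiv ℝ).isCompact.isBounded.subset_closedBall 0
  -- For `l` within `1/2` of `1`, `l • x` in the ball of radius `R` forces `‖x‖ ≤ 2 * R`; this fixes
  -- the dominating function.
  have h1 := (hasDerivAt_integral_of_dominated_loc_of_deriv_le (μ := volume)
    (F := fun (l : ℝ) (x : Space N) => ‖x‖ ^ (-a) * χ (l • x))
    (F' := fun (l : ℝ) (x : Space N) => ‖x‖ ^ (-a) * fderiv ℝ χ (l • x) x)
    (bound := (Metric.closedBall (0 : Space N) (2 * R)).indicator
      fun x => ‖x‖ ^ (-a) * (M * (2 * R)))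
    (Metric.ball_mem_nhds (1 : ℝ) (by norm_num : (0 : ℝ) < 1 / 2)) ?_ ?_ ?_ ?_ ?_ ?_).2
  · have h2 : HasDerivAt (fun l : ℝ => ∫ x : Space N, ‖x‖ ^ (-a) * χ (l • x))
        ((a - N) * ∫ x : Space N, ‖x‖ ^ (-a) * χ x) 1 := by
      have h3 := (Real.hasDerivAt_rpow_const (x := 1) (p := a - N) (Or.inl one_ne_zero)).mul_const
        (∫ x : Space N, ‖x‖ ^ (-a) * χ x)
      rw [Real.one_rpow, mul_one] at h3
      refine h3.congr_of_eventuallyEq ?_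
      filter_upwards [eventually_gt_nhds one_pos] with l hl
      exact integral_norm_rpow_mul_comp_smul hN a χ hl
    have h4 := h1.unique h2
    simp only [one_smul] at h4
    rw [h4]; ring
  · exact Eventually.of_forall fun l => (Measurable.aestronglyMeasurable (by fun_prop)).mul
      (hχ.continuous.comp (continuous_const_smul l)).aestronglyMeasurable
  · simp only [one_smul, mul_comm (‖_‖ ^ (-a))]
    exact hloc.integrable_smul_left_of_hasCompactSupport hχ.continuous hc
  · refine (Measurable.aestronglyMeasurable (by fun_prop)).mul (Continuous.aestronglyMeasurable ?_)
    exact (hd.comp (continuous_const_smul _)).clm_apply continuous_id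
  · refine Eventually.of_forall fun x l hl => ?_
    rw [Metric.mem_ball, Real.dist_eq, abs_lt] at hl
    rw [norm_mul, Real.norm_of_nonneg (by positivity)]
    by_cases h0 : fderiv ℝ χ (l • x) = 0
    · rw [h0]
      simp only [zero_apply, norm_zero, mul_zero]
      refine indicator_nonneg (fun y hy => ?_) x
      have hR0 : 0 ≤ 2 * R := (norm_nonneg y).trans (mem_closedBall_zero_iff.1 hy)
      have hM0 : 0 ≤ M := (norm_nonneg _).trans (hM 0)
      positivity
    · have hmem : l • x ∈ Metric.closedBall (0 : Space N) R :=
        hR (subset_tsupport _ (Function.mem_support.2 h0))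
      rw [mem_closedBall_zero_iff, norm_smul, Real.norm_of_nonneg (by linarith)] at hmem
      have hx : ‖x‖ ≤ 2 * R := by nlinarith [norm_nonneg x]
      rw [indicator_of_mem (mem_closedBall_zero_iff.2 hx)]
      gcongr
      refine (ContinuousLinearMap.le_opNorm _ _).trans ?_
      have hM0 : 0 ≤ M := (norm_nonneg _).trans (hM 0)
      gcongr
      exact hM _
  · rw [integrable_indicator_iff measurableSet_closedBall]
    exact (hloc.integrableOn_isCompact (isCompact_closedBall _ _)).mul_const _
  · refine Eventually.of_forall fun x l _ => ?_
    have h5 : HasDerivAt (fun l : ℝ => l • x) x l := by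
      simpa using! (hasDerivAt_id l).smul_const x
    exact ((hχ.differentiable one_ne_zero (l • x)).hasFDerivAt.comp_hasDerivAt l h5).const_mul _

lemma locallyIntegrable_smul_prod {E : Type*} [NormedAddCommGroup E] [NormedSpace ℝ E]
    {g : ℝ → ℝ} (hg : Continuous g) {F : Space N → E} (hF : LocallyIntegrable F) :
    LocallyIntegrable (fun z : Space N × ℝ => g z.2 • F z.1) (spaceTime N) := by
  rintro ⟨x, t⟩
  obtain ⟨U, hU, hUi⟩ := hF x
  refine ⟨U ×ˢ Icc (t - 1) (t + 1),
    prod_mem_nhds hU (Icc_mem_nhds (by linarith) (by linarith)), ?_⟩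
  have hgi : IntegrableOn g (Icc (t - 1) (t + 1)) (volume.restrict (Ioi 0)) :=
    (hg.integrableOn_Icc).mono_measure Measure.restrict_le_self
  have h := (hgi.smul_prod hUi).swap
  rw [IntegrableOn, spaceTime, ← Measure.prod_restrict]
  exact h

/-! ### Separable functions `h t * ‖x‖ ^ (-a)` -/

section Separable

variable {a s m κ : ℝ} {h : ℝ → ℝ}

/-- The relation `has` makes `-a (m - 1) - (a - 2s) - 2` equal to `-a`, so the flux is
`v`-homogeneous times the Euler field. -/
lemma flux_eq (ha : 0 < a) (hm0 : 0 < m) (hm1 : m < 1) (has : a * (1 - m) = 2 - 2 * s)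
    (hnn : ∀ t, 0 ≤ h t) (t : ℝ) (x : Space N) :
    flux m (fun x t => h t * ‖x‖ ^ (-a))
      (fun x t => h t * (-κ * powPrimitive (a - 2 * s) ‖x‖)) t x =
      (-(κ * h t ^ m) * ‖x‖ ^ (-a)) • x := by
  have hm : m - 1 ≠ 0 := by linarith
  rw [flux]
  rcases eq_or_ne x 0 with rfl | hx
  -- At the origin `0 ^ (-a) = 0` and `0 ^ (m - 1) = 0` by convention, so the formula holds there
  -- too.
  · rw [norm_zero, Real.zero_rpow (by linarith), mul_zero, Real.zero_rpow hm, zero_smul, smul_zero]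
  rcases (hnn t).eq_or_lt with h0 | h0
  · rw [← h0, zero_mul, Real.zero_rpow hm, zero_smul, Real.zero_rpow hm0.ne', mul_zero, neg_zero,
      zero_mul, zero_smul]
  have hx0 : 0 < ‖x‖ := norm_pos_iff.2 hx
  have hgrad : HasGradientAt (fun y : Space N => h t * (-κ * powPrimitive (a - 2 * s) ‖y‖))
      ((h t * (-κ * ‖x‖ ^ (-(a - 2 * s) - 2))) • x) x := by
    rw [hasGradientAt_iff_hasFDerivAt]
    convert! ((hasFDerivAt_powPrimitive_norm (a - 2 * s) hx).const_mul (-κ)).const_mul (h t) using 1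
    ext y
    simp
    ring_nf
  rw [hgrad.gradient, smul_smul, Real.mul_rpow h0.le (by positivity), ← Real.rpow_mul hx0.le]
  congr 1
  have h1 : ‖x‖ ^ (-a * (m - 1)) * ‖x‖ ^ (-(a - 2 * s) - 2) = ‖x‖ ^ (-a) := by
    rw [← Real.rpow_add hx0]
    congr 1
    linarith
  have h2 : h t ^ (m - 1) * h t = h t ^ m := by
    rw [Real.rpow_sub_one h0.ne']
    field_simp
  rw [← h1, ← h2]
  ring

lemma solvesOffOrigin_separable (ha : 0 < a) (hm0 : 0 < m) (hm1 : m < 1)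
    (has : a * (1 - m) = 2 - 2 * s) (hnn : ∀ t, 0 ≤ h t)
    (hode : ∀ t, HasDerivAt h (-(κ * (N - a) * h t ^ m)) t) :
    SolvesOffOrigin m (fun (x : Space N) t => h t * ‖x‖ ^ (-a))
      (fun x t => h t * (-κ * powPrimitive (a - 2 * s) ‖x‖)) := by
  intro t _ x hx
  have hfl : flux m (fun (x : Space N) t => h t * ‖x‖ ^ (-a))
      (fun x t => h t * (-κ * powPrimitive (a - 2 * s) ‖x‖)) t =
      fun x => (-(κ * h t ^ m) * ‖x‖ ^ (-a)) • x :=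
    funext fun x => flux_eq ha hm0 hm1 has hnn t x
  rw [hfl, divergence_norm_rpow_smul _ _ hx]
  refine ⟨?_, (hasFDerivAt_norm_rpow_smul _ _ hx).differentiableAt, ?_⟩
  · exact (((hasFDerivAt_powPrimitive_norm (a - 2 * s) hx).const_mul (-κ)).const_mul
      (h t)).differentiableAt
  · convert! (hode t).mul_const (‖x‖ ^ (-a)) using 1
    ring

lemma hasCompactSupport_slice_left {E : Type*} [Zero E] {φ : Space N × ℝ → E}
    (hc : HasCompactSupport φ) (t : ℝ) : HasCompactSupport fun x => φ (x, t) :=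
  HasCompactSupport.intro (hc.isCompact.image continuous_fst) fun x hx =>
    image_eq_zero_of_notMem_tsupport fun h => hx ⟨(x, t), h, rfl⟩

lemma hasCompactSupport_slice_right {E : Type*} [Zero E] {φ : Space N × ℝ → E}
    (hc : HasCompactSupport φ) (x : Space N) : HasCompactSupport fun t => φ (x, t) :=
  HasCompactSupport.intro (hc.isCompact.image continuous_snd) fun t ht =>
    image_eq_zero_of_notMem_tsupport fun h => ht ⟨(x, t), h, rfl⟩

lemma integrable_mul_norm_rpow_mul (hN : 1 ≤ N) (haN : a < N) {g : ℝ → ℝ} (hg : Continuous g)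
    {w : Space N × ℝ → ℝ} (hw : Continuous w) (hc : HasCompactSupport w) :
    Integrable (fun z => g z.2 * ‖z.1‖ ^ (-a) * w z) (spaceTime N) :=
  (locallyIntegrable_smul_prod hg
    (isTemperedFun_norm_rpow hN haN).locallyIntegrable).integrable_smul_right_of_hasCompactSupport
    hw hc

/-- The Euler field is integrated by parts in `x`. -/
lemma integral_mul_fderiv_euler (hN : 1 ≤ N) (haN : a < N) {g : ℝ → ℝ} (hg : Continuous g)
    {φ : Space N × ℝ → ℝ} (hφ : ContDiff ℝ 1 φ) (hc : HasCompactSupport φ) :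
    ∫ z, g z.2 * ‖z.1‖ ^ (-a) * fderiv ℝ φ z (z.1, 0) ∂(spaceTime N) =
      ∫ z, -(N - a) * (g z.2 * ‖z.1‖ ^ (-a) * φ z) ∂(spaceTime N) := by
  have hd := hφ.continuous_fderiv one_ne_zero
  have hi1 := integrable_mul_norm_rpow_mul hN haN hg
    (hd.clm_apply (continuous_fst.prodMk continuous_const : Continuous
      fun z : Space N × ℝ => (z.1, (0 : ℝ))))
    ((hc.fderiv ℝ).mono fun z hz h0 => hz (by simp [h0]))
  have hi2 := (integrable_mul_norm_rpow_mul hN haN hg hφ.continuous hc).const_mul (-(N - a))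
  rw [spaceTime] at hi1 hi2 ⊢
  rw [integral_prod_symm _ hi1, integral_prod_symm _ hi2]
  refine integral_congr_ae (Eventually.of_forall fun t => ?_)
  have h1 : ContDiff ℝ 1 fun x : Space N => φ (x, t) :=
    hφ.comp (contDiff_id.prodMk contDiff_const)
  have h2 := integral_norm_rpow_mul_fderiv_self hN haN h1 (hasCompactSupport_slice_left hc t)
  have h3 : ∀ x : Space N, fderiv ℝ (fun x => φ (x, t)) x x = fderiv ℝ φ (x, t) (x, 0) := by
    intro x
    have := HasFDerivAt.comp (g := φ) (f := fun y => (y, t)) x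
      (hφ.differentiable one_ne_zero (x, t)).hasFDerivAt (hasFDerivAt_prodMk_left x t)
    rw [HasFDerivAt.fderiv (f := fun x => φ (x, t)) this]
    simp
  simp only [h3] at h2
  simp only [mul_assoc, integral_const_mul]
  rw [h2]
  ring

lemma integral_Ioi_deriv_mul (hh : ContDiff ℝ 1 h) {φ : Space N × ℝ → ℝ} (hφ : ContDiff ℝ 1 φ)
    (hc : HasCompactSupport φ) (x : Space N) :
    ∫ t in Ioi (0 : ℝ), (h t * fderiv ℝ φ (x, t) (0, 1) + deriv h t * φ (x, t)) =
      -(h 0 * φ (x, 0)) := by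
  have h1 : ContDiff ℝ 1 fun t : ℝ => φ (x, t) := hφ.comp (contDiff_const.prodMk contDiff_id)
  have h2 := HasCompactSupport.integral_Ioi_deriv_eq (f := fun t => h t * φ (x, t)) (hh.mul h1)
    ((hasCompactSupport_slice_right hc x).mul_left) 0
  rw [← h2]
  refine integral_congr_ae (Eventually.of_forall fun t => ?_)
  have h3 : HasDerivAt (fun t => φ (x, t)) (fderiv ℝ φ (x, t) (0, 1)) t := by
    have := ((hφ.differentiable one_ne_zero (x, t)).hasFDerivAt.comp t
      (hasFDerivAt_prodMk_right x t)).hasDerivAt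
    convert! this using 1
  have h4 := (hh.differentiable one_ne_zero t).hasDerivAt
  rw [HasDerivAt.deriv (f := fun t => h t * φ (x, t)) (h4.mul h3)]
  simp only
  ring

lemma solvesWeakly_separable (hN : 1 ≤ N) (ha : 0 < a) (haN : a < N) (hm0 : 0 < m) (hm1 : m < 1)
    (has : a * (1 - m) = 2 - 2 * s) (hnn : ∀ t, 0 ≤ h t)
    (hode : ∀ t, HasDerivAt h (-(κ * (N - a) * h t ^ m)) t) :
    SolvesWeakly m (fun (x : Space N) t => h t * ‖x‖ ^ (-a))
      (fun x t => h t * (-κ * powPrimitive (a - 2 * s) ‖x‖)) := by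
  have hcont : Continuous h := continuous_iff_continuousAt.2 fun t => (hode t).continuousAt
  have hcm : Continuous fun t => h t ^ m := hcont.rpow_const fun _ => Or.inr hm0.le
  have hderiv : deriv h = fun t => -(κ * (N - a) * h t ^ m) := funext fun t => (hode t).deriv
  have hcd : Continuous (deriv h) := by rw [hderiv]; fun_prop
  have hh : ContDiff ℝ 1 h :=
    contDiff_one_iff_deriv.2 ⟨fun t => (hode t).differentiableAt, hcd⟩
  have hloc := (isTemperedFun_norm_rpow hN haN).locallyIntegrable
  have hfl := flux_eq (N := N) (κ := κ) ha hm0 hm1 has hnn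
  refine ⟨?_, locallyIntegrable_smul_prod hcont hloc, ?_, fun φ hφ hc => ?_⟩
  · exact hloc.smul (h 0)
  · have h1 : LocallyIntegrable (fun x : Space N => (‖x‖ ^ (-a)) • x) :=
      hloc.smul_continuous continuous_id
    convert! locallyIntegrable_smul_prod (g := fun t => -(κ * h t ^ m)) (by fun_prop) h1 using 2
      with z
    rw [hfl, mul_smul]
  have hφ1 : ContDiff ℝ 1 φ := hφ.of_le (by exact_mod_cast le_top)
  have hd := hφ1.continuous_fderiv one_ne_zero
  have hi1 := integrable_mul_norm_rpow_mul hN haN hcont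
    (hd.clm_apply (continuous_const (y := ((0 : Space N), (1 : ℝ)))))
    ((hc.fderiv ℝ).mono fun z hz h0 => hz (by simp [h0]))
  have hi2 := integrable_mul_norm_rpow_mul hN haN (hcm.const_mul κ)
    (hd.clm_apply (continuous_fst.prodMk continuous_const : Continuous
      fun z : Space N × ℝ => (z.1, (0 : ℝ))))
    ((hc.fderiv ℝ).mono fun z hz h0 => hz (by simp [h0]))
  have hi3 := (integrable_mul_norm_rpow_mul hN haN (hcm.const_mul κ) hφ1.continuous hc).const_mul
    (-(N - a))
  have h1 : ∀ z : Space N × ℝ, fderiv ℝ φ z (flux m (fun (x : Space N) t => h t * ‖x‖ ^ (-a))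
      (fun x t => h t * (-κ * powPrimitive (a - 2 * s) ‖x‖)) z.2 z.1, 0) =
      -(κ * h z.2 ^ m * ‖z.1‖ ^ (-a) * fderiv ℝ φ z (z.1, 0)) := by
    intro z
    rw [hfl, ← smul_zero (-(κ * h z.2 ^ m) * ‖z.1‖ ^ (-a)), ← Prod.smul_mk, map_smul, smul_eq_mul]
    ring_nf
  simp only [h1, sub_neg_eq_add]
  -- After integrating the Euler field by parts, the ODE makes the integrand `‖x‖^(-a) ∂ₜ(h φ)`; its
  -- time integral leaves only the initial term.
  rw [integral_add hi1 hi2, integral_mul_fderiv_euler hN haN (hcm.const_mul κ) hφ1 hc,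
    ← integral_add hi1 hi3]
  have h2 := integral_prod _ (hi1.add hi3)
  have h3 : ∀ x : Space N, ∫ t in Ioi (0 : ℝ), (h t * ‖x‖ ^ (-a) * fderiv ℝ φ (x, t) (0, 1) +
      -(N - a) * (κ * h t ^ m * ‖x‖ ^ (-a) * φ (x, t))) = -(h 0 * ‖x‖ ^ (-a) * φ (x, 0)) := by
    intro x
    rw [mul_right_comm, ← neg_mul, ← integral_Ioi_deriv_mul hh hφ1 hc x, ← integral_mul_const,
      hderiv]
    refine integral_congr_ae (Eventually.of_forall fun t => ?_)
    simp only
    ring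
  simp only [Pi.add_apply, h3, integral_neg] at h2
  change ∫ z, _ ∂(spaceTime N) = _ at h2
  rw [h2, neg_add_cancel]

end Separable

/-! ### The extinction ODE and the assembly of the solution. -/

/-- Since `q > 1`, the right derivative at `0` vanishes and matches the left one; this is what lets
the profile pass through extinction differentiably. -/
lemma hasDerivAt_max_zero_rpow {q : ℝ} (hq : 1 < q) (y : ℝ) :
    HasDerivAt (fun y : ℝ => (max y 0) ^ q) (q * (max y 0) ^ (q - 1)) y := by
  have hz : (0 : ℝ) ^ q = 0 := Real.zero_rpow (by linarith)
  rcases lt_trichotomy y 0 with h | rfl | h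
  · rw [max_eq_right h.le, Real.zero_rpow (by linarith), mul_zero]
    refine (hasDerivAt_const y (0 : ℝ)).congr_of_eventuallyEq ?_
    filter_upwards [eventually_lt_nhds h] with z hz'
    rw [max_eq_right hz'.le, hz]
  · rw [max_self, ← hasDerivWithinAt_univ, ← Iic_union_Ici (a := (0 : ℝ))]
    refine HasDerivWithinAt.union ?_ ?_
    · rw [Real.zero_rpow (by linarith), mul_zero]
      refine (hasDerivWithinAt_const (0 : ℝ) (Iic 0) (0 : ℝ)).congr_of_mem (fun z hz' => ?_)
        self_mem_Iic
      rw [max_eq_right hz', hz]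
    · refine (Real.hasDerivAt_rpow_const (x := 0) (Or.inr hq.le)).hasDerivWithinAt.congr_of_mem
        (fun z hz' => ?_) self_mem_Ici
      rw [max_eq_left hz']
  · rw [max_eq_left h.le]
    refine (Real.hasDerivAt_rpow_const (Or.inl h.ne')).congr_of_eventuallyEq ?_
    filter_upwards [eventually_gt_nhds h] with z hz'
    rw [max_eq_left hz'.le]

/-- The solution of `h' = -c h ^ m` that vanishes from the time `T` on. -/
lemma hasDerivAt_extinction {m c : ℝ} (hm0 : 0 < m) (hm1 : m < 1) (hc : 0 < c) (T t : ℝ) :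
    HasDerivAt (fun t => (c * (1 - m)) ^ (1 / (1 - m)) * (max (T - t) 0) ^ (1 / (1 - m)))
      (-(c * ((c * (1 - m)) ^ (1 / (1 - m)) * (max (T - t) 0) ^ (1 / (1 - m))) ^ m)) t := by
  have hm : 0 < 1 - m := sub_pos.2 hm1
  have hq : 1 < 1 / (1 - m) := by rw [lt_div_iff₀ hm]; linarith
  have hcm : 0 < c * (1 - m) := mul_pos hc hm
  have h1 : HasDerivAt (fun t : ℝ => T - t) (-1) t := by
    simpa using! (hasDerivAt_id t).const_sub T
  have h2 := ((hasDerivAt_max_zero_rpow hq (T - t)).comp t h1).const_mul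
    ((c * (1 - m)) ^ (1 / (1 - m)))
  convert! h2 using 1
  have hmax : 0 ≤ max (T - t) 0 := le_max_right _ _
  -- With `q = 1 / (1 - m)`, `h^m` has the same exponent `q - 1` as `h'`; the coefficient `(c (1 -
  -- m))^q` then balances the constants.
  have hexp : 1 / (1 - m) * m = 1 / (1 - m) - 1 := by field_simp; ring
  rw [Real.mul_rpow (by positivity) (by positivity), ← Real.rpow_mul hcm.le, ← Real.rpow_mul hmax,
    hexp, Real.rpow_sub_one hcm.ne']
  field_simp

lemma isVerySingularSolutionWithExtinction_separable (hN : 1 ≤ N) {a s m κ T : ℝ} {h : ℝ → ℝ}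
    (ha : 0 < a) (haN : a < N) (hm0 : 0 < m) (hm1 : m < 1) (has : a * (1 - m) = 2 - 2 * s)
    (hκ : ∀ c : ℝ, IsInvFracLaplacian s (fun x : Space N => c * ‖x‖ ^ (-a))
      (fun x => c * (-κ * powPrimitive (a - 2 * s) ‖x‖)))
    (hnn : ∀ t, 0 ≤ h t) (hode : ∀ t, HasDerivAt h (-(κ * (N - a) * h t ^ m)) t)
    (hpos : ∀ t < T, 0 < h t) (hzero : ∀ t, T < t → h t = 0) :
    IsVerySingularSolutionWithExtinction s m T (fun (x : Space N) t => h t * ‖x‖ ^ (-a)) where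
  solution := ⟨fun x t => h t * (-κ * powPrimitive (a - 2 * s) ‖x‖), fun t _ => hκ (h t),
    solvesOffOrigin_separable ha hm0 hm1 has hnn hode,
    solvesWeakly_separable hN ha haN hm0 hm1 has hnn hode⟩
  pos t ht x hx := mul_pos (hpos t ht.2) (Real.rpow_pos_of_pos (norm_pos_iff.2 hx) _)
  singular t ht := Tendsto.const_mul_atTop (hpos t ht.2)
    ((tendsto_rpow_neg_nhdsGT_zero (neg_neg_iff_pos.2 ha)).comp tendsto_norm_nhdsNE_zero)
  extinct t ht x := by rw [hzero t ht, zero_mul]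

end FracPressure


theorem mainTheorem6 (N : ℕ) (hN : 1 ≤ N) (s m : ℝ) (hs0 : 0 < s) (hs1 : s < 1)
    (hm0 : 0 < m) (hm1 : m < ((N : ℝ) - 2 + 2 * s) / (N : ℝ)) :
    ∃ K : ℝ, 0 < K ∧ ∀ T : ℝ, 0 < T →
      ∃ v : FracPressure.Space N → ℝ → ℝ,
        FracPressure.IsVerySingularSolutionWithExtinction s m T v ∧
        (∀ x : FracPressure.Space N, x ≠ 0 → ∀ t : ℝ, 0 ≤ t → t ≤ T →
          v x t = K * (T - t) ^ (1 / (1 - m)) * ‖x‖ ^ (-((2 - 2 * s) / (1 - m)))) ∧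
        (∀ x : FracPressure.Space N, ∀ t : ℝ, T < t → v x t = 0) := by
  have hN0 : (0 : ℝ) < N := by exact_mod_cast hN
  rw [lt_div_iff₀ hN0] at hm1
  have hm1' : m < 1 := by
    by_contra! hge
    nlinarith
  have hm : 0 < 1 - m := sub_pos.2 hm1'
  have ha : 0 < (2 - 2 * s) / (1 - m) := div_pos (by linarith) hm
  have haN : (2 - 2 * s) / (1 - m) < N := by rw [div_lt_iff₀ hm]; linarith
  have has : (2 - 2 * s) / (1 - m) * (1 - m) = 2 - 2 * s := div_mul_cancel₀ _ hm.ne'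
  set a := (2 - 2 * s) / (1 - m)
  obtain ⟨κ, hκ, hinv⟩ := FracPressure.exists_isInvFracLaplacian hN ha haN hs0 hs1
  have hc : 0 < κ * (N - a) := mul_pos hκ (sub_pos.2 haN)
  have hK : 0 < (κ * (N - a) * (1 - m)) ^ (1 / (1 - m)) := Real.rpow_pos_of_pos (mul_pos hc hm) _
  have hq : 1 / (1 - m) ≠ 0 := one_div_ne_zero hm.ne'
  refine ⟨(κ * (N - a) * (1 - m)) ^ (1 / (1 - m)), hK, fun T _ => ?_⟩
  have hzero : ∀ t, T < t →
      (κ * (N - a) * (1 - m)) ^ (1 / (1 - m)) * (max (T - t) 0) ^ (1 / (1 - m)) = 0 := by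
    intro t ht
    rw [max_eq_right (by linarith), Real.zero_rpow hq, mul_zero]
  refine ⟨fun x t => (κ * (N - a) * (1 - m)) ^ (1 / (1 - m)) *
    (max (T - t) 0) ^ (1 / (1 - m)) * ‖x‖ ^ (-a), ?_, ?_, ?_⟩
  · refine FracPressure.isVerySingularSolutionWithExtinction_separable hN ha haN hm0 hm1' has hinv
      (fun t => ?_) (fun t => ?_) (fun t ht => ?_) hzero
    · exact mul_nonneg hK.le (Real.rpow_nonneg (le_max_right _ _) _)
    · exact FracPressure.hasDerivAt_extinction hm0 hm1' hc T t
    · exact mul_pos hK (Real.rpow_pos_of_pos (lt_max_of_lt_left (sub_pos.2 ht)) _)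
  · intro x _ t _ ht
    simp only [max_eq_left (sub_nonneg.2 ht)]
  · intro x t ht
    simp only [hzero t ht, zero_mul]
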